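/- Let $\mathbb T^d=\mathbb R^d/2\pi\mathbb Z^d$ carry the normalised Lebesgue measure, let $e_k(x)=e^{\mathbf i\langle k,x\rangle}$ for $k\in\mathbb Z^d$, and for a distribution $u\in\mathcal S'(\mathbb T^d,\mathbb C)$ let $u_k=\int_{\mathbb T^d}u(x)e_{-k}(x)\,dx$ be its Fourier coefficients and $\Pi_N u=\sum_{|k|\le N}u_ke_k$ its Fourier truncations. Let $\chi_{-1},\chi\in C^\infty(\mathbb R^d,[0,1])$ with $\operatorname{supp}\chi_{-1}\subset\{|x|\le 4/3\}$, $\operatorname{supp}\chi\subset\{3/4<|x|\le 8/3\}$ and $\sum_{\ell\ge-1}\chi_\ell=1$, where $\chi_\ell=\chi(2^{-\ell}\cdot)$ for $\ell\ge0$; put $\Delta_\ell u=\sum_k\chi_\ell(k)u_ke_k$. For $\alpha\in\mathbb R$ and $1\le p,q\le\infty$ let $|u|_{B^\alpha_{p,q}}=\big(\sum_{\ell\ge-1}2^{\alpha\ell q}|\Delta_\ell u|_{L^p(\mathbb T^d)}^q\big)^{1/q}$ (a supremum over $\ell$ if $q=\infty$), and let $B^\alpha_{p,q}$ be the completion of $C^\infty(\mathbb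 T^d)$ under this norm, regarded as a subspace of $\mathcal S'(\mathbb T^d,\mathbb C)$. Let $X$ be a real Gaussian Fourier series on $\mathbb T^d$, that is, an $\mathcal S'(\mathbb T^d,\mathbb C)$-valued random variable such that $(X_k)_{k\in\mathbb Z^d}$ is a centred, jointly Gaussian family of complex random variables with $\mathbb E X_k^2=0$ for all $k\ne0$, with $X_k$ and $X_n$ independent whenever $k\notin\{-n,n\}$, and with $X_{-k}=\overline{X_k}$ almost surely for all $k$. Write $\sigma^2(n)=\mathbb E|X_n|^2$. Let $\gamma,\theta,\eta\in\mathbb R$ and suppose that there are constants $C,R$ such that $$\sigma^2(n)\le C\,|n|^\gamma(\log|n|)^\theta(\log\log|n|)^\eta\qquad\text{for all } n\in\mathbb Z^d \text{ with } |n|>R .$$ (i) If $\theta=-1$ and $\eta<0$, then almost surely $X\in B^{-(d+\gamma)/2}_{\infty,\infty}$ and $\lim_{N\to\infty}|\Pi_NX-X|_{B^{-(d+\gamma)/2}_{\infty,\infty}}=0$. (ii) If $\theta<-1$, $q\in[1,\infty]$ and $q>-2/(\theta+1)$, then almost surely $X\in B^{-(d+\gamma)/2}_{\infty,q}$ and $\lim_{N\to\infty}|\Pi_NX-X|_{B^{-(d+\gamma)/2}_{\infty,q}}=0$.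 -/

import Mathlib

open MeasureTheory ProbabilityTheory Filter Topology
open scoped ENNReal

noncomputable section

/-- The torus `ℝ^d / 2πℤ^d`. -/
abbrev FlatTorus (d : ℕ) : Type := Fin d → AddCircle (2 * Real.pi)

namespace FlatTorus

instance factTwoPiPos : Fact (0 < 2 * Real.pi) := ⟨Real.two_pi_pos⟩

/-- The normalised Lebesgue measure on the torus, of total mass one. -/
def vol (d : ℕ) : Measure (FlatTorus d) := Measure.pi fun _ => AddCircle.haarAddCircle

instance isProbabilityMeasure_vol (d : ℕ) : IsProbabilityMeasure (vol d) := by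
  unfold vol; infer_instance

/-- The quotient map `ℝ^d → 𝕋^d`. -/
def proj {d : ℕ} (x : EuclideanSpace ℝ (Fin d)) : FlatTorus d :=
  fun i => (x i : AddCircle (2 * Real.pi))

theorem surjective_proj {d : ℕ} : Function.Surjective (proj (d := d)) := by
  intro y
  choose x hx using fun i => QuotientAddGroup.mk_surjective (y i)
  exact ⟨WithLp.toLp 2 x, funext hx⟩

/-- `C^∞(𝕋^d, ℂ)`: the functions on the torus whose periodic lift to `ℝ^d` is smooth. -/
def Smooth (d : ℕ) : Submodule ℂ C(FlatTorus d, ℂ) where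
  carrier := {f | ContDiff ℝ (⊤ : ℕ∞) fun x : EuclideanSpace ℝ (Fin d) => f (proj x)}
  add_mem' := fun {f g} hf hg => by
    simp only [Set.mem_ofPred_eq] at hf hg ⊢
    exact hf.add hg
  zero_mem' := by
    simp only [Set.mem_ofPred_eq]
    exact contDiff_const
  smul_mem' := fun c f hf => by
    simp only [Set.mem_ofPred_eq] at hf ⊢
    exact hf.const_smul c

/-- The lattice point `k ∈ ℤ^d`, seen in Euclidean space. -/
def freq {d : ℕ} (k : Fin d → ℤ) : EuclideanSpace ℝ (Fin d) :=
  WithLp.toLp 2 fun i => (k i : ℝ)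

/-- The character `x ↦ e^{i⟨k,x⟩}` as a continuous function on the torus. -/
def char {d : ℕ} (k : Fin d → ℤ) : C(FlatTorus d, ℂ) where
  toFun := fun x : FlatTorus d => ∏ i, fourier (k i) (x i)
  continuous_toFun :=
    continuous_finsetProd _ fun i _ => (fourier (k i)).continuous.comp (continuous_apply i)

theorem char_proj {d : ℕ} (k : Fin d → ℤ) (x : EuclideanSpace ℝ (Fin d)) :
    char k (proj x) = Complex.exp (Complex.I * ((inner ℝ (freq k) x : ℝ) : ℂ)) := by
  have h : ((inner ℝ (freq k) x : ℝ) : ℂ) = ∑ i, (k i : ℂ) * (x i : ℂ) := by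
    simp [freq, PiLp.inner_apply, mul_comm]
  rw [h, Finset.mul_sum, Complex.exp_sum]
  change ∏ i, (fourier (k i) (proj x i) : ℂ) = _
  refine Finset.prod_congr rfl fun i _ => ?_
  have hpi : (Real.pi : ℂ) ≠ 0 := by exact_mod_cast Real.pi_ne_zero
  simp only [proj, fourier_coe_apply]
  congr 1
  push_cast
  field_simp

/-- The Fourier basis element `e_k` in `C^∞(𝕋^d)`. -/
def e {d : ℕ} (k : Fin d → ℤ) : Smooth d :=
  ⟨char k, by
    change ContDiff ℝ (⊤ : ℕ∞) fun x : EuclideanSpace ℝ (Fin d) => char k (proj x)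
    simp only [char_proj]
    have h : ContDiff ℝ (⊤ : ℕ∞) fun x : EuclideanSpace ℝ (Fin d) => (inner ℝ (freq k) x : ℝ) :=
      contDiff_const.inner ℝ contDiff_id
    exact (contDiff_const.mul (Complex.ofRealCLM.contDiff.comp h)).cexp⟩

/-- The distributions `𝒮'(𝕋^d, ℂ)`: linear forms on `C^∞(𝕋^d)` which are continuous, that is,
bounded by a multiple of a `C^m` norm for some `m`. -/
def Distr (d : ℕ) : Submodule ℂ (Smooth d →ₗ[ℂ] ℂ) where
  carrier := {u | ∃ (C : ℝ) (m : ℕ), ∀ (φ : Smooth d) (B : ℝ),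
    (∀ j ≤ m, ∀ x : EuclideanSpace ℝ (Fin d),
      ‖iteratedFDeriv ℝ j (fun y : EuclideanSpace ℝ (Fin d) => φ.1 (proj y)) x‖ ≤ B) →
    ‖u φ‖ ≤ C * B}
  add_mem' := by
    rintro u v ⟨C, m, hu⟩ ⟨C', m', hv⟩
    refine ⟨C + C', max m m', fun φ B hB => ?_⟩
    have h1 := hu φ B fun j hj => hB j (hj.trans (le_max_left _ _))
    have h2 := hv φ B fun j hj => hB j (hj.trans (le_max_right _ _))
    have h3 := norm_add_le (u φ) (v φ)
    rw [LinearMap.add_apply, add_mul]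
    linarith
  zero_mem' := ⟨0, 0, fun φ B _ => by simp⟩
  smul_mem' := by
    rintro c u ⟨C, m, hu⟩
    refine ⟨‖c‖ * C, m, fun φ B hB => ?_⟩
    rw [LinearMap.smul_apply, smul_eq_mul, norm_mul, mul_assoc]
    exact mul_le_mul_of_nonneg_left (hu φ B hB) (norm_nonneg c)

theorem integrable_mul {d : ℕ} (f g : C(FlatTorus d, ℂ)) :
    Integrable (fun x => f x * g x) (vol d) :=
  (f * g).continuous.integrable_of_hasCompactSupport (HasCompactSupport.of_compactSpace _)

/-- The distribution `φ ↦ ∫ f φ` given by a smooth function `f`. -/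
def toDistr {d : ℕ} (f : Smooth d) : Distr d :=
  ⟨{ toFun := fun φ => ∫ x, f.1 x * φ.1 x ∂vol d
     map_add' := fun φ ψ => by
       rw [← integral_add (integrable_mul f.1 φ.1) (integrable_mul f.1 ψ.1)]
       exact integral_congr_ae (ae_of_all _ fun x => mul_add _ _ _)
     map_smul' := fun c φ => by
       rw [RingHom.id_apply, smul_eq_mul, ← integral_const_mul]
       exact integral_congr_ae (ae_of_all _ fun x => mul_left_comm _ _ _) },
   by
    refine ⟨‖f.1‖, 0, fun φ B hB => ?_⟩
    have hφ : ∀ x, ‖φ.1 x‖ ≤ B := fun x => by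
      obtain ⟨y, rfl⟩ := surjective_proj x
      simpa using hB 0 le_rfl y
    have h := norm_integral_le_of_norm_le_const (μ := vol d) (C := ‖f.1‖ * B)
      (f := fun x => f.1 x * φ.1 x) (ae_of_all _ fun x => by
        rw [norm_mul]
        exact mul_le_mul (f.1.norm_coe_le_norm x) (hφ x) (norm_nonneg _) (norm_nonneg _))
    simpa using h⟩

/-- The Fourier coefficient `u_k`, which is `∫ u(x) e_{-k}(x) dx` for a function `u`. -/
def coeff {d : ℕ} (u : Distr d) (k : Fin d → ℤ) : ℂ := u.1 (e (-k))

theorem finite_norm_freq_le (d : ℕ) (R : ℝ) : {k : Fin d → ℤ | ‖freq k‖ ≤ R}.Finite := by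
  refine (Set.finite_Icc (fun _ : Fin d => -⌈R⌉) (fun _ => ⌈R⌉)).subset fun k hk => ?_
  have h : ∀ i, |(k i : ℝ)| ≤ (⌈R⌉ : ℝ) := fun i => by
    have h1 := PiLp.norm_apply_le (freq k) i
    simp only [freq, Real.norm_eq_abs] at h1
    exact h1.trans (le_trans hk (Int.le_ceil R))
  constructor <;> intro i
  · have := (abs_le.1 (h i)).1
    exact_mod_cast this
  · have := (abs_le.1 (h i)).2
    exact_mod_cast this

/-- The Fourier truncation `Π_N u = ∑_{|k| ≤ N} u_k e_k`, with the Euclidean norm of `k`. -/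
def trunc {d : ℕ} (N : ℕ) (u : Distr d) : Smooth d :=
  ∑ k ∈ (finite_norm_freq_le d N).toFinset, coeff u k • e k

/-- A pair `χ_{-1}, χ` generating a smooth dyadic partition of unity
`χ_{-1} + ∑_{ℓ ≥ 0} χ(2^{-ℓ} ·) = 1` on `ℝ^d`. -/
structure DyadicPartition (d : ℕ) where
  chiLow : EuclideanSpace ℝ (Fin d) → ℝ
  chi : EuclideanSpace ℝ (Fin d) → ℝ
  contDiff_chiLow : ContDiff ℝ (⊤ : ℕ∞) chiLow
  contDiff_chi : ContDiff ℝ (⊤ : ℕ∞) chi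
  chiLow_mem : ∀ x, chiLow x ∈ Set.Icc (0 : ℝ) 1
  chi_mem : ∀ x, chi x ∈ Set.Icc (0 : ℝ) 1
  tsupport_chiLow : tsupport chiLow ⊆ Metric.closedBall 0 (4 / 3)
  tsupport_chi : tsupport chi ⊆ Metric.closedBall 0 (8 / 3) \ Metric.closedBall 0 (3 / 4)
  hasSum_one : ∀ x, HasSum (fun ℓ : ℕ => chi (((2 : ℝ) ^ ℓ)⁻¹ • x)) (1 - chiLow x)

/-- The cut-off `χ_ℓ` for `ℓ = j - 1`, `j = 0, 1, 2, …`. -/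
def DyadicPartition.cutoff {d : ℕ} (χ : DyadicPartition d) :
    ℕ → EuclideanSpace ℝ (Fin d) → ℝ
  | 0 => χ.chiLow
  | ℓ + 1 => fun x => χ.chi (((2 : ℝ) ^ ℓ)⁻¹ • x)

theorem DyadicPartition.finite_cutoff_ne_zero {d : ℕ} (χ : DyadicPartition d) (j : ℕ) :
    {k : Fin d → ℤ | χ.cutoff j (freq k) ≠ 0}.Finite := by
  cases j with
  | zero =>
    refine (finite_norm_freq_le d (4 / 3)).subset fun k hk => ?_
    simpa using χ.tsupport_chiLow (subset_tsupport _ hk)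
  | succ ℓ =>
    refine (finite_norm_freq_le d (2 ^ ℓ * (8 / 3))).subset fun k hk => ?_
    have h := (χ.tsupport_chi (subset_tsupport _ hk)).1
    have h2 : (0 : ℝ) < 2 ^ ℓ := by positivity
    rw [mem_closedBall_zero_iff, norm_smul, norm_inv, Real.norm_of_nonneg h2.le,
      inv_mul_le_iff₀ h2] at h
    exact h

/-- The Littlewood--Paley block `Δ_ℓ u = ∑_k χ_ℓ(k) u_k e_k` for `ℓ = j - 1`. -/
def block {d : ℕ} (χ : DyadicPartition d) (j : ℕ) (u : Distr d) : Smooth d :=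
  ∑ k ∈ (χ.finite_cutoff_ne_zero j).toFinset, ((χ.cutoff j (freq k) : ℂ) * coeff u k) • e k

/-- The Besov norm `(∑_{ℓ ≥ -1} 2^{αℓq} |Δ_ℓ u|_{L^p}^q)^{1/q}` of a distribution, with values in
`[0, ∞]`; for `q = ∞` the `ℓ^q` norm is a supremum. The index is `j = ℓ + 1`. -/
def besovNorm {d : ℕ} (χ : DyadicPartition d) (α : ℝ) (p q : ℝ≥0∞) (u : Distr d) : ℝ≥0∞ :=
  let a : ℕ → ℝ≥0∞ := fun j =>
    ENNReal.ofReal ((2 : ℝ) ^ (α * ((j : ℝ) - 1))) * eLpNorm (block χ j u).1 p (vol d)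
  if q = ∞ then ⨆ j, a j else (∑' j, a j ^ q.toReal) ^ (1 / q.toReal)

/-- The Besov space `B^α_{p,q}`, the completion of `C^∞(𝕋^d)` under the Besov norm realised inside
the distributions: the distributions which are limits of smooth functions in that norm. -/
def besovSpace {d : ℕ} (χ : DyadicPartition d) (α : ℝ) (p q : ℝ≥0∞) : Set (Distr d) :=
  {u | ∃ f : ℕ → Smooth d, Tendsto (fun n => besovNorm χ α p q (toDistr (f n) - u)) atTop (𝓝 0)}

/-- `X` is a real Gaussian Fourier series: a random distribution whose Fourier coefficients form a
centred (jointly) Gaussian family of complex random variables with `E[X_k^2] = 0` for `k ≠ 0`, such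
that `X_k` and `X_n` are independent for `k ∉ {-n, n}` and `X_{-k}` is the conjugate of `X_k`. -/
structure IsRealGFS {d : ℕ} {Ω : Type*} [MeasurableSpace Ω] (P : Measure Ω) (X : Ω → Distr d) :
    Prop where
  measurable : ∀ φ : Smooth d, Measurable fun ω => (X ω).1 φ
  gaussian : IsGaussianProcess (fun (k : Fin d → ℤ) ω => coeff (X ω) k) P
  centred : ∀ k, ∫ ω, coeff (X ω) k ∂P = 0
  integral_sq : ∀ k, k ≠ 0 → ∫ ω, coeff (X ω) k ^ 2 ∂P = 0
  indep : ∀ k n, k ≠ n → k ≠ -n →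
    IndepFun (fun ω => coeff (X ω) k) (fun ω => coeff (X ω) n) P
  conj : ∀ᵐ ω ∂P, ∀ k, coeff (X ω) (-k) = starRingEnd ℂ (coeff (X ω) k)

end FlatTorus

end

noncomputable section

namespace FlatTorus

/-! At a fixed point, the `j`-th Littlewood-Paley block of `Π_N X - X` is a centred complex
Gaussian. Distinct modes are orthogonal and all multipliers have modulus at most one, so its
variance is at most the sum of `σ²` over the block. That sum is `V_j ≲ 2^{j(d+γ)} j^θ (log j)^η`,
uniformly in the point and in `N`.

A trigonometric polynomial of degree `O(2^j)` is controlled by its values on a grid of `2^{O(j)}`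
points (`norm_le_of_gridPoint`). The block vanishes once `N ≥ 2^{j+1}`, so only `2^{O(j)}` Gaussian
variables matter. A union bound costs a factor `√j`, and Borel-Cantelli gives, almost surely and for
all large `j`, a sup norm `≲ √(j V_j)` uniformly in `N` (`IsRealGFS.ae_eventually_norm_block_le`).

The weight `2^{-j(d+γ)/2}` cancels the exponential growth and leaves `√(j^{1+θ} (log j)^η)`. This
tends to zero in case (i), and is `q`-summable (or tends to zero if `q = ∞`) in case (ii). As the
low blocks vanish for large `N`, the Besov norm of `Π_N X - X` is bounded by a tail of this
sequence. Membership in the space follows because the truncations are smooth. -/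

theorem integral_fourier (n : ℤ) :
    ∫ x : AddCircle (2 * Real.pi), (fourier n x : ℂ) ∂AddCircle.haarAddCircle =
      if n = 0 then 1 else 0 := by
  split_ifs with h
  · subst h
    simp
  -- Translation by half a wavelength, `π / n`, preserves Haar measure and changes the sign of the
  -- character.
  · exact integral_eq_zero_of_add_right_eq_neg (μ := AddCircle.haarAddCircle)
      (fourier_add_half_inv_index h Real.two_pi_pos)

theorem integral_char {d : ℕ} (k : Fin d → ℤ) :
    ∫ x, char k x ∂vol d = if k = 0 then 1 else 0 := by
  have h : ∫ x, char k x ∂vol d =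
      ∏ i, ∫ x : AddCircle (2 * Real.pi), (fourier (k i) x : ℂ) ∂AddCircle.haarAddCircle :=
    integral_fintype_prod_eq_prod (fun i (x : AddCircle (2 * Real.pi)) => (fourier (k i) x : ℂ))
  rw [h]
  simp only [integral_fourier]
  split_ifs with hk
  · subst hk
    simp
  · obtain ⟨i, hi⟩ := Function.ne_iff.1 hk
    exact Finset.prod_eq_zero (Finset.mem_univ i) (if_neg hi)

theorem char_mul_char {d : ℕ} (k n : Fin d → ℤ) (x : FlatTorus d) :
    char k x * char n x = char (k + n) x := by
  change (∏ i, (fourier (k i) (x i) : ℂ)) * ∏ i, (fourier (n i) (x i) : ℂ) =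
    ∏ i, (fourier ((k + n) i) (x i) : ℂ)
  rw [← Finset.prod_mul_distrib]
  exact Finset.prod_congr rfl fun i _ => fourier_add.symm

theorem norm_char {d : ℕ} (k : Fin d → ℤ) (x : FlatTorus d) : ‖char k x‖ = 1 := by
  change ‖∏ i, (fourier (k i) (x i) : ℂ)‖ = 1
  rw [norm_prod]
  exact Finset.prod_eq_one fun i _ => Circle.norm_coe _

theorem coeff_toDistr_e {d : ℕ} (k n : Fin d → ℤ) :
    coeff (toDistr (e k)) n = if k = n then 1 else 0 := by
  change ∫ x, char k x * char (-n) x ∂vol d = _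
  simp only [char_mul_char, integral_char, ← sub_eq_add_neg, sub_eq_zero]

theorem coeff_toDistr {d : ℕ} (f : Smooth d) (n : Fin d → ℤ) :
    coeff (toDistr f) n = ∫ x, f.1 x * char (-n) x ∂vol d := rfl

theorem coeff_toDistr_sum {d : ℕ} (S : Finset (Fin d → ℤ)) (c : (Fin d → ℤ) → ℂ)
    (n : Fin d → ℤ) :
    coeff (toDistr (∑ k ∈ S, c k • e k)) n = if n ∈ S then c n else 0 := by
  have h : ∀ x, (∑ k ∈ S, c k • e k : Smooth d).1 x * char (-n) x =
      ∑ k ∈ S, c k * (char k x * char (-n) x) := fun x => by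
    rw [AddSubmonoidClass.coe_finsetSum, ContinuousMap.sum_apply, Finset.sum_mul]
    exact Finset.sum_congr rfl fun k _ => mul_assoc _ _ _
  rw [coeff_toDistr, integral_congr_ae (ae_of_all _ h),
    integral_finsetSum _ fun k _ => (integrable_mul _ _).const_mul _]
  have h2 : ∀ k, ∫ x, c k * (char k x * char (-n) x) ∂vol d = if k = n then c k else 0 :=
    fun k => by
      rw [integral_const_mul, show ∫ x, char k x * char (-n) x ∂vol d = _ from coeff_toDistr_e k n]
      simp
  simp [h2]

theorem coeff_sub {d : ℕ} (u v : Distr d) (n : Fin d → ℤ) :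
    coeff (u - v) n = coeff u n - coeff v n := rfl

theorem norm_coeff_toDistr_le {d : ℕ} (f : Smooth d) (n : Fin d → ℤ) :
    ‖coeff (toDistr f) n‖ ≤ ‖f.1‖ := by
  have h := norm_integral_le_of_norm_le_const (μ := vol d) (C := ‖f.1‖)
    (f := fun x => f.1 x * char (-n) x) (ae_of_all _ fun x => by
      rw [norm_mul, norm_char, mul_one]
      exact f.1.norm_coe_le_norm x)
  simpa [coeff_toDistr] using h

/-! ### Sup norms of trigonometric polynomials by sampling -/

theorem norm_char_proj_sub_le {d : ℕ} (k : Fin d → ℤ) (x y : EuclideanSpace ℝ (Fin d)) :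
    ‖char k (proj x) - char k (proj y)‖ ≤ ∑ i, |(k i : ℝ)| * |x i - y i| := by
  have h1 : char k (proj x) - char k (proj y) = char k (proj y) *
      (Complex.exp (Complex.I * ((inner ℝ (freq k) (x - y) : ℝ) : ℂ)) - 1) := by
    rw [char_proj, char_proj, mul_sub, mul_one, ← Complex.exp_add, ← mul_add,
      ← Complex.ofReal_add, ← inner_add_right, add_sub_cancel]
  rw [h1, norm_mul, norm_char, one_mul]
  refine Real.norm_exp_I_mul_ofReal_sub_one_le.trans ?_
  rw [PiLp.inner_apply]
  refine (norm_sum_le _ _).trans (Finset.sum_le_sum fun i _ => le_of_eq ?_)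
  simp [freq, mul_comm]

/-- The point with coordinates `2π g_i / n` of the regular grid of mesh `2π / n` in the torus. -/
def gridPoint {d : ℕ} (n : ℕ) (g : Fin d → Fin n) : FlatTorus d :=
  proj (WithLp.toLp 2 fun i => 2 * Real.pi * (g i : ℝ) / n)

theorem exists_gridPoint_near {d : ℕ} {n : ℕ} (hn : 0 < n) (y : FlatTorus d) :
    ∃ (g : Fin d → Fin n) (x : EuclideanSpace ℝ (Fin d)), proj x = y ∧
      ∀ i, |x i - 2 * Real.pi * (g i : ℝ) / n| ≤ 2 * Real.pi / n := by
  have hn' : (0 : ℝ) < n := by exact_mod_cast hn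
  have hpi := Real.two_pi_pos
  have key : ∀ z : AddCircle (2 * Real.pi), ∃ (g : Fin n) (x : ℝ),
      (x : AddCircle (2 * Real.pi)) = z ∧ |x - 2 * Real.pi * (g : ℝ) / n| ≤ 2 * Real.pi / n := by
    intro z
    obtain ⟨x, ⟨hx0, hx1⟩, rfl⟩ : ∃ x ∈ Set.Ico (0 : ℝ) (0 + 2 * Real.pi),
        (x : AddCircle (2 * Real.pi)) = z := by
      have := AddCircle.coe_image_Ico_eq (2 * Real.pi) 0
      have hz : z ∈ (Set.univ : Set (AddCircle (2 * Real.pi))) := Set.mem_univ z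
      rw [← this] at hz
      exact hz
    rw [zero_add] at hx1
    have hq0 : 0 ≤ n * x / (2 * Real.pi) := by positivity
    have hq1 : n * x / (2 * Real.pi) < n := by
      rw [div_lt_iff₀ hpi]
      exact mul_lt_mul_of_pos_left hx1 hn'
    refine ⟨⟨⌊n * x / (2 * Real.pi)⌋₊, (Nat.floor_lt hq0).2 hq1⟩, x, rfl, ?_⟩
    have h1 := Nat.floor_le hq0
    have h2 := (Nat.lt_floor_add_one (n * x / (2 * Real.pi))).le
    set m := ⌊n * x / (2 * Real.pi)⌋₊
    rw [le_div_iff₀ hpi] at h1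
    rw [div_le_iff₀ hpi] at h2
    have h3 : x - 2 * Real.pi * (m : ℝ) / n = (n * x - m * (2 * Real.pi)) / n := by
      field_simp
    change |x - 2 * Real.pi * (m : ℝ) / n| ≤ _
    rw [h3, abs_of_nonneg (div_nonneg (by linarith) hn'.le)]
    gcongr
    linarith
  choose g x hx hgx using key
  exact ⟨fun i => g (y i), WithLp.toLp 2 fun i => x (y i), funext fun i => hx _, fun i => hgx _⟩

/-- A trigonometric polynomial is controlled by its values on a sufficiently fine grid. -/
theorem norm_le_of_gridPoint {d : ℕ} {n M D : ℕ} (hn : 0 < n) (S : Finset (Fin d → ℤ))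
    (hS : ∀ k ∈ S, ∀ i, |(k i : ℝ)| ≤ M) (hD : S.card ≤ D)
    (hnM : 4 * Real.pi * d * M * D ≤ n) (c : (Fin d → ℤ) → ℂ) {B : ℝ} (hB : 0 ≤ B)
    (hg : ∀ g : Fin d → Fin n, ‖(∑ k ∈ S, c k • e k : Smooth d).1 (gridPoint n g)‖ ≤ B) :
    ‖(∑ k ∈ S, c k • e k : Smooth d).1‖ ≤ 2 * B := by
  set f : Smooth d := ∑ k ∈ S, c k • e k with hf
  have hn' : (0 : ℝ) < n := by exact_mod_cast hn
  have hc : ∀ k ∈ S, ‖c k‖ ≤ ‖f.1‖ := fun k hk => by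
    have h := norm_coeff_toDistr_le f k
    rwa [hf, coeff_toDistr_sum, if_pos hk] at h
  have hfx : ∀ x, f.1 x = ∑ k ∈ S, c k * char k x := fun x => by
    rw [hf, AddSubmonoidClass.coe_finsetSum, ContinuousMap.sum_apply]
    rfl
  -- Self-improvement: each coefficient is at most `‖f‖`, so on a fine enough grid the oscillation
  -- of `f` over one cell is at most `‖f‖ / 2`, which is then absorbed on the left.
  have hle : ‖f.1‖ ≤ B + ‖f.1‖ / 2 := by
    refine (ContinuousMap.norm_le _ (by positivity)).2 fun y => ?_
    obtain ⟨g, x, rfl, hx⟩ := exists_gridPoint_near hn y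
    have h1 : ‖f.1 (proj x) - f.1 (gridPoint n g)‖ ≤ ‖f.1‖ / 2 := by
      rw [hfx, hfx, ← Finset.sum_sub_distrib]
      calc ‖∑ k ∈ S, (c k * char k (proj x) - c k * char k (gridPoint n g))‖
          ≤ ∑ k ∈ S, ‖f.1‖ * (d * (M * (2 * Real.pi / n))) := by
            refine norm_sum_le_of_le _ fun k hk => ?_
            rw [← mul_sub, norm_mul]
            refine mul_le_mul (hc k hk) ?_ (norm_nonneg _) (norm_nonneg _)
            refine (norm_char_proj_sub_le k _ _).trans ?_
            refine (Finset.sum_le_card_nsmul _ _ (M * (2 * Real.pi / n)) fun i _ =>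
              mul_le_mul (hS k hk i) (hx i) (abs_nonneg _) (Nat.cast_nonneg _)).trans ?_
            simp
        _ = ‖f.1‖ / 2 * ((4 * Real.pi * d * M * S.card) / n) := by
            rw [Finset.sum_const, nsmul_eq_mul]
            ring
        _ ≤ ‖f.1‖ / 2 * 1 := by
            refine mul_le_mul_of_nonneg_left ?_ (by positivity)
            rw [div_le_one hn']
            refine le_trans ?_ hnM
            have : (S.card : ℝ) ≤ D := by exact_mod_cast hD
            gcongr
        _ = _ := mul_one _
    calc ‖f.1 (proj x)‖ = ‖f.1 (gridPoint n g) + (f.1 (proj x) - f.1 (gridPoint n g))‖ := by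
          rw [add_sub_cancel]
      _ ≤ _ := (norm_add_le _ _).trans (add_le_add (hg g) h1)
  linarith

/-! ### Gaussian tail bounds -/

section GaussianTail

variable {Ω : Type*} [MeasurableSpace Ω] {P : Measure Ω}

theorem hasSubgaussianMGF_of_hasGaussianLaw {Y : Ω → ℝ} (hY : HasGaussianLaw Y P)
    (h0 : ∫ ω, Y ω ∂P = 0) {V : NNReal} (hV : ∫ ω, Y ω ^ 2 ∂P ≤ V) :
    HasSubgaussianMGF Y V P := by
  have := hY.isProbabilityMeasure
  have hmap := hY.map_eq_gaussianReal
  rw [h0] at hmap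
  have hvar : Var[Y; P] ≤ V :=
    (variance_le_expectation_sq hY.aemeasurable.aestronglyMeasurable).trans (by simpa using hV)
  refine ⟨fun t => ?_, fun t => ?_⟩
  · have h := integrable_exp_mul_gaussianReal (μ := 0) (v := Var[Y; P].toNNReal) t
    rw [← hmap] at h
    exact (integrable_map_measure h.1 hY.aemeasurable).1 h
  · rw [mgf_gaussianReal hmap]
    refine Real.exp_le_exp.2 ?_
    rw [zero_mul, zero_add]
    have : ((Var[Y; P].toNNReal : NNReal) : ℝ) ≤ V := by
      rw [Real.coe_toNNReal _ (variance_nonneg _ _)]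
      exact hvar
    gcongr

/-- Chernoff's bound applied to `Y` and `-Y`. For `V = 0` the quotient is `0` by convention, and the
bound `2` is trivial. -/
theorem measure_le_abs_le_of_hasGaussianLaw {Y : Ω → ℝ} (hY : HasGaussianLaw Y P)
    (h0 : ∫ ω, Y ω ∂P = 0) {V t : ℝ} (hV0 : 0 ≤ V) (hV : ∫ ω, Y ω ^ 2 ∂P ≤ V) (ht : 0 ≤ t) :
    P {ω | t ≤ |Y ω|} ≤ ENNReal.ofReal (2 * Real.exp (-t ^ 2 / (2 * V))) := by
  have := hY.isProbabilityMeasure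
  lift V to NNReal using hV0
  have h := hasSubgaussianMGF_of_hasGaussianLaw hY h0 hV
  have h1 := h.measure_ge_le ht
  have h2 := h.neg.measure_ge_le ht
  have hsub : {ω | t ≤ |Y ω|} ⊆ {ω | t ≤ Y ω} ∪ {ω | t ≤ (-Y) ω} := fun ω hω => by
    simpa [le_abs] using hω
  rw [← ofReal_measureReal]
  refine ENNReal.ofReal_le_ofReal ((measureReal_mono hsub).trans
    ((measureReal_union_le _ _).trans ?_))
  linarith

/-- If `t ≤ ‖Z‖`, then the real or the imaginary part is at least `t / 2` in absolute value, whence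
`(t / 2)² / (2V) = t² / (8V)`. No relation between the two parts is needed. -/
theorem measure_le_norm_le_of_hasGaussianLaw {Z : Ω → ℂ} (hZ : HasGaussianLaw Z P)
    (h0 : ∫ ω, Z ω ∂P = 0) {V t : ℝ} (hV : ∫ ω, ‖Z ω‖ ^ 2 ∂P ≤ V) (ht : 0 ≤ t) :
    P {ω | t ≤ ‖Z ω‖} ≤ ENNReal.ofReal (4 * Real.exp (-t ^ 2 / (8 * V))) := by
  have hV0 : 0 ≤ V := le_trans (integral_nonneg fun ω => by positivity) hV
  have hint : Integrable (fun ω => ‖Z ω‖ ^ 2) P := hZ.memLp_two.integrable_norm_pow (by norm_num)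
  have hre : HasGaussianLaw (fun ω => (Z ω).re) P := hZ.map_fun Complex.reCLM
  have him : HasGaussianLaw (fun ω => (Z ω).im) P := hZ.map_fun Complex.imCLM
  have hre0 : ∫ ω, (Z ω).re ∂P = 0 := by
    have h := Complex.reCLM.integral_comp_comm hZ.integrable
    simpa [h0] using h
  have him0 : ∫ ω, (Z ω).im ∂P = 0 := by
    have h := Complex.imCLM.integral_comp_comm hZ.integrable
    simpa [h0] using h
  have hreV : ∫ ω, (Z ω).re ^ 2 ∂P ≤ V := by
    refine (integral_mono_of_nonneg (ae_of_all _ fun ω => sq_nonneg _) hint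
      (ae_of_all _ fun ω => ?_)).trans hV
    exact sq_le_sq.2 (by simpa using Complex.abs_re_le_norm (Z ω))
  have himV : ∫ ω, (Z ω).im ^ 2 ∂P ≤ V := by
    refine (integral_mono_of_nonneg (ae_of_all _ fun ω => sq_nonneg _) hint
      (ae_of_all _ fun ω => ?_)).trans hV
    exact sq_le_sq.2 (by simpa using Complex.abs_im_le_norm (Z ω))
  have ht2 : 0 ≤ t / 2 := by positivity
  have h1 := measure_le_abs_le_of_hasGaussianLaw hre hre0 hV0 hreV ht2
  have h2 := measure_le_abs_le_of_hasGaussianLaw him him0 hV0 himV ht2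
  have hsub : {ω | t ≤ ‖Z ω‖} ⊆ {ω | t / 2 ≤ |(Z ω).re|} ∪ {ω | t / 2 ≤ |(Z ω).im|} :=
    fun ω hω => by
      by_contra hc
      simp only [Set.mem_union, Set.mem_ofPred_eq, not_or, not_le] at hc hω
      have := Complex.norm_le_abs_re_add_abs_im (Z ω)
      linarith [hc.1, hc.2]
  refine (measure_mono hsub).trans ((measure_union_le _ _).trans ((add_le_add h1 h2).trans ?_))
  rw [← ENNReal.ofReal_add (by positivity) (by positivity)]
  refine ENNReal.ofReal_le_ofReal (le_of_eq ?_)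
  rw [show -(t / 2) ^ 2 / (2 * V) = -t ^ 2 / (8 * V) by
    rw [div_pow, ← neg_div, div_div]; ring_nf]
  ring

end GaussianTail

/-! ### Orthogonality of the Fourier modes -/

section SecondMoment

variable {d : ℕ} {Ω : Type*} [MeasurableSpace Ω] {P : Measure Ω} {X : Ω → Distr d}

theorem IsRealGFS.hasGaussianLaw_coeff (hX : IsRealGFS P X) (k : Fin d → ℤ) :
    HasGaussianLaw (fun ω => coeff (X ω) k) P :=
  hX.gaussian.hasGaussianLaw_eval k

theorem IsRealGFS.hasGaussianLaw_sum (hX : IsRealGFS P X) (S : Finset (Fin d → ℤ))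
    (b : (Fin d → ℤ) → ℂ) : HasGaussianLaw (fun ω => ∑ k ∈ S, b k * coeff (X ω) k) P :=
  (hX.gaussian.comp_left fun k => ContinuousLinearMap.mul ℝ ℂ (b k)).hasGaussianLaw_fun_sum

theorem IsRealGFS.integral_sum (hX : IsRealGFS P X) (S : Finset (Fin d → ℤ))
    (b : (Fin d → ℤ) → ℂ) : ∫ ω, ∑ k ∈ S, b k * coeff (X ω) k ∂P = 0 := by
  rw [integral_finsetSum _ fun k _ => (hX.hasGaussianLaw_coeff k).integrable.const_mul _]
  refine Finset.sum_eq_zero fun k _ => ?_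
  rw [integral_const_mul, hX.centred, mul_zero]

/-- The conjugate of `X_n` is `X_{-n}`. Either `k = -n`, and the integral is `E X_k² = 0`, or `X_k`
and `X_{-n}` are independent and centred. -/
theorem IsRealGFS.integral_mul_conj (hX : IsRealGFS P X) {k n : Fin d → ℤ} (h : k ≠ n) :
    ∫ ω, coeff (X ω) k * starRingEnd ℂ (coeff (X ω) n) ∂P = 0 := by
  have h1 : ∀ᵐ ω ∂P, coeff (X ω) k * starRingEnd ℂ (coeff (X ω) n) =
      coeff (X ω) k * coeff (X ω) (-n) := by
    filter_upwards [hX.conj] with ω hω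
    rw [hω]
  rw [integral_congr_ae h1]
  by_cases hkn : k = -n
  · subst hkn
    simp only [← sq]
    -- The zero mode is excluded: it would force `k = n = 0`.
    refine hX.integral_sq _ fun h0 => h ?_
    rw [h0, ← neg_neg n, h0, neg_zero]
  · rw [(hX.indep k (-n) hkn (by rwa [neg_neg])).integral_fun_mul_eq_mul_integral
      (hX.hasGaussianLaw_coeff _).aemeasurable.aestronglyMeasurable
      (hX.hasGaussianLaw_coeff _).aemeasurable.aestronglyMeasurable, hX.centred, zero_mul]

theorem IsRealGFS.integral_norm_sum_sq (hX : IsRealGFS P X) (S : Finset (Fin d → ℤ))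
    (b : (Fin d → ℤ) → ℂ) :
    ∫ ω, ‖∑ k ∈ S, b k * coeff (X ω) k‖ ^ 2 ∂P =
      ∑ k ∈ S, ‖b k‖ ^ 2 * ∫ ω, ‖coeff (X ω) k‖ ^ 2 ∂P := by
  have hint : ∀ k n, Integrable
      (fun ω => coeff (X ω) k * starRingEnd ℂ (coeff (X ω) n)) P := fun k n =>
    (hX.hasGaussianLaw_coeff k).memLp_two.integrable_mul
      ((hX.hasGaussianLaw_coeff n).map_fun Complex.conjCLE.toContinuousLinearMap).memLp_two
  have hsq : ∀ z : ℂ, ((‖z‖ ^ 2 : ℝ) : ℂ) = z * starRingEnd ℂ z := fun z => by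
    rw [Complex.mul_conj, Complex.normSq_eq_norm_sq]
  apply Complex.ofReal_injective
  rw [← integral_complex_ofReal, Complex.ofReal_sum]
  have h1 : ∀ ω, ((‖∑ k ∈ S, b k * coeff (X ω) k‖ ^ 2 : ℝ) : ℂ) =
      ∑ k ∈ S, ∑ n ∈ S, b k * starRingEnd ℂ (b n) *
        (coeff (X ω) k * starRingEnd ℂ (coeff (X ω) n)) := fun ω => by
    rw [hsq, map_sum, Finset.sum_mul_sum]
    refine Finset.sum_congr rfl fun k _ => Finset.sum_congr rfl fun n _ => ?_
    rw [map_mul]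
    ring
  rw [integral_congr_ae (ae_of_all _ h1),
    integral_finsetSum _ fun k _ => integrable_finsetSum _ fun n _ => (hint k n).const_mul _]
  refine Finset.sum_congr rfl fun k hk => ?_
  rw [integral_finsetSum _ fun n _ => (hint k n).const_mul _,
    Finset.sum_eq_single_of_mem k hk fun n _ hn => by
      rw [integral_const_mul, hX.integral_mul_conj hn.symm, mul_zero],
    integral_const_mul, Complex.ofReal_mul, ← integral_complex_ofReal, hsq]
  simp only [hsq]

end SecondMoment

/-! ### Dyadic blocks of the truncation error -/

section Blocks

variable {d : ℕ}

/-- The finite set of lattice points in the support of the `j`-th cut-off. -/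
def DyadicPartition.modes (χ : DyadicPartition d) (j : ℕ) : Finset (Fin d → ℤ) :=
  (χ.finite_cutoff_ne_zero j).toFinset

theorem DyadicPartition.norm_freq_le (χ : DyadicPartition d) {j : ℕ} {k : Fin d → ℤ}
    (hk : k ∈ χ.modes j) : ‖freq k‖ ≤ 4 / 3 * 2 ^ j := by
  have hk' : χ.cutoff j (freq k) ≠ 0 := (Set.Finite.mem_toFinset _).1 hk
  cases j with
  | zero => simpa using χ.tsupport_chiLow (subset_tsupport _ hk')
  | succ ℓ =>
    have h := (χ.tsupport_chi (subset_tsupport _ hk')).1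
    have h2 : (0 : ℝ) < 2 ^ ℓ := by positivity
    rw [mem_closedBall_zero_iff, norm_smul, norm_inv, Real.norm_of_nonneg h2.le,
      inv_mul_le_iff₀ h2] at h
    rw [pow_succ]
    linarith

theorem DyadicPartition.lt_norm_freq (χ : DyadicPartition d) {j : ℕ} (hj : j ≠ 0)
    {k : Fin d → ℤ} (hk : k ∈ χ.modes j) : 3 / 8 * 2 ^ j < ‖freq k‖ := by
  have hk' : χ.cutoff j (freq k) ≠ 0 := (Set.Finite.mem_toFinset _).1 hk
  obtain ⟨ℓ, rfl⟩ := Nat.exists_eq_succ_of_ne_zero hj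
  have h := (χ.tsupport_chi (subset_tsupport _ hk')).2
  have h2 : (0 : ℝ) < 2 ^ ℓ := by positivity
  rw [mem_closedBall_zero_iff, norm_smul, norm_inv, Real.norm_of_nonneg h2.le,
    inv_mul_le_iff₀ h2, not_le] at h
  rw [Nat.succ_eq_add_one, pow_succ]
  linarith

theorem DyadicPartition.abs_le_of_mem_modes (χ : DyadicPartition d) {j : ℕ} {k : Fin d → ℤ}
    (hk : k ∈ χ.modes j) (i : Fin d) : |(k i : ℝ)| ≤ ((2 ^ (j + 1) : ℕ) : ℝ) := by
  have h1 := PiLp.norm_apply_le (freq k) i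
  simp only [freq, Real.norm_eq_abs] at h1
  refine h1.trans ((χ.norm_freq_le hk).trans ?_)
  have h2 : (0 : ℝ) < 2 ^ j := by positivity
  push_cast
  rw [pow_succ]
  linarith

theorem DyadicPartition.card_modes_le (χ : DyadicPartition d) (j : ℕ) :
    (χ.modes j).card ≤ 2 ^ ((j + 3) * d) := by
  -- The box has `2^{j+2} + 1 ≤ 2^{j+3}` integers in each direction.
  have hsub : χ.modes j ⊆ Fintype.piFinset fun _ : Fin d =>
      Finset.Icc (-(2 ^ (j + 1) : ℤ)) (2 ^ (j + 1)) := fun k hk => by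
    refine Fintype.mem_piFinset.2 fun i => Finset.mem_Icc.2 (abs_le.1 ?_)
    have h := χ.abs_le_of_mem_modes hk i
    exact_mod_cast h
  refine (Finset.card_le_card hsub).trans ?_
  rw [Fintype.card_piFinset_const, Int.card_Icc, pow_mul]
  refine Nat.pow_le_pow_left ?_ d
  have h : (0 : ℤ) < 2 ^ j := by positivity
  zify
  rw [pow_succ, pow_add, Int.toNat_of_nonneg (by omega)]
  omega

theorem DyadicPartition.norm_cutoff_le_one (χ : DyadicPartition d) (j : ℕ)
    (x : EuclideanSpace ℝ (Fin d)) : ‖(χ.cutoff j x : ℂ)‖ ≤ 1 := by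
  have h : χ.cutoff j x ∈ Set.Icc (0 : ℝ) 1 := by
    cases j with
    | zero => exact χ.chiLow_mem x
    | succ ℓ => exact χ.chi_mem _
  rw [Complex.norm_real, Real.norm_of_nonneg h.1]
  exact h.2

/-- The Fourier multiplier of `u ↦ Δ_{j-1}(Π_N u - u)`. -/
def remainderSymbol (χ : DyadicPartition d) (N j : ℕ) (k : Fin d → ℤ) : ℂ :=
  χ.cutoff j (freq k) * if ‖freq k‖ ≤ N then 0 else -1

theorem norm_remainderSymbol_le_one (χ : DyadicPartition d) (N j : ℕ) (k : Fin d → ℤ) :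
    ‖remainderSymbol χ N j k‖ ≤ 1 := by
  rw [remainderSymbol, norm_mul]
  refine mul_le_one₀ (χ.norm_cutoff_le_one j _) (norm_nonneg _) ?_
  split_ifs <;> simp

theorem coeff_toDistr_trunc (N : ℕ) (u : Distr d) (k : Fin d → ℤ) :
    coeff (toDistr (trunc N u)) k = if ‖freq k‖ ≤ N then coeff u k else 0 := by
  rw [trunc, coeff_toDistr_sum]
  simp

theorem block_trunc_sub (χ : DyadicPartition d) (N j : ℕ) (u : Distr d) :
    block χ j (toDistr (trunc N u) - u) =
      ∑ k ∈ χ.modes j, (remainderSymbol χ N j k * coeff u k) • e k := by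
  refine Finset.sum_congr rfl fun k _ => ?_
  rw [coeff_sub, coeff_toDistr_trunc, remainderSymbol]
  congr 1
  split_ifs <;> ring

/-- All frequencies of the block lie below `(4/3) 2^j < 2^{j+1}`. This leaves finitely many `N` for
the union bound, and later turns Besov norms into tails. -/
theorem block_trunc_sub_eq_zero (χ : DyadicPartition d) {N j : ℕ} (h : 2 ^ (j + 1) ≤ N)
    (u : Distr d) : block χ j (toDistr (trunc N u) - u) = 0 := by
  rw [block_trunc_sub]
  refine Finset.sum_eq_zero fun k hk => ?_
  have h1 : ‖freq k‖ ≤ N := by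
    refine (χ.norm_freq_le hk).trans (le_trans ?_ (Nat.cast_le.2 h))
    have h2 : (0 : ℝ) < 2 ^ j := by positivity
    push_cast
    rw [pow_succ]
    linarith
  rw [remainderSymbol, if_pos h1, mul_zero, zero_mul, zero_smul]

variable {Ω : Type*} [MeasurableSpace Ω] {P : Measure Ω} {X : Ω → Distr d}

/-- The truncation, the cut-off and the character only multiply `X_k` by numbers of modulus at most
one, so the variance bound is free of `N` and `x`. -/
theorem IsRealGFS.measure_le_norm_block_apply (hX : IsRealGFS P X) (χ : DyadicPartition d)
    (N j : ℕ) (x : FlatTorus d) {V t : ℝ}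
    (hV : ∑ k ∈ χ.modes j, ∫ ω, ‖coeff (X ω) k‖ ^ 2 ∂P ≤ V) (ht : 0 ≤ t) :
    P {ω | t ≤ ‖(block χ j (toDistr (trunc N (X ω)) - X ω)).1 x‖} ≤
      ENNReal.ofReal (4 * Real.exp (-t ^ 2 / (8 * V))) := by
  set b : (Fin d → ℤ) → ℂ := fun k => remainderSymbol χ N j k * char k x with hb
  have hb1 : ∀ k, ‖b k‖ ≤ 1 := fun k => by
    rw [hb, norm_mul, norm_char, mul_one]
    exact norm_remainderSymbol_le_one χ N j k
  have hF : ∀ ω, (block χ j (toDistr (trunc N (X ω)) - X ω)).1 x =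
      ∑ k ∈ χ.modes j, b k * coeff (X ω) k := fun ω => by
    rw [block_trunc_sub, AddSubmonoidClass.coe_finsetSum, ContinuousMap.sum_apply]
    refine Finset.sum_congr rfl fun k _ => ?_
    change remainderSymbol χ N j k * coeff (X ω) k * char k x = _
    rw [hb]
    ring
  simp only [hF]
  refine measure_le_norm_le_of_hasGaussianLaw (hX.hasGaussianLaw_sum _ b) (hX.integral_sum _ b)
    ?_ ht
  rw [hX.integral_norm_sum_sq]
  refine (Finset.sum_le_sum fun k _ => ?_).trans hV
  exact mul_le_of_le_one_left (integral_nonneg fun ω => by positivity)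
    (pow_le_one₀ (norm_nonneg _) (hb1 k))

/-- The number of points per direction of a grid that resolves the `j`-th block. -/
def gridSize (d j : ℕ) : ℕ := 2 ^ ((j + 5) * (d + 1))

theorem le_gridSize (d j : ℕ) : 4 * Real.pi * d * ((2 ^ (j + 1) : ℕ) : ℝ) *
    ((2 ^ ((j + 3) * d) : ℕ) : ℝ) ≤ (gridSize d j : ℝ) := by
  have hd : (d : ℝ) ≤ 2 ^ d := by exact_mod_cast Nat.lt_two_pow_self.le
  have hpi := Real.pi_le_four
  have hpi0 := Real.pi_pos
  calc 4 * Real.pi * d * ((2 ^ (j + 1) : ℕ) : ℝ) * ((2 ^ ((j + 3) * d) : ℕ) : ℝ)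
      ≤ 4 * 4 * 2 ^ d * 2 ^ (j + 1) * 2 ^ ((j + 3) * d) := by
        push_cast
        gcongr
    _ = ((2 : ℝ) ^ (4 + d + (j + 1) + (j + 3) * d)) := by
        rw [pow_add _ _ ((j + 3) * d), pow_add _ _ (j + 1), pow_add _ 4 d]
        norm_num
    _ ≤ 2 ^ ((j + 5) * (d + 1)) := by
        refine pow_le_pow_right₀ (by norm_num) ?_
        ring_nf
        omega
    _ = (gridSize d j : ℝ) := by
        rw [gridSize]
        push_cast
        rfl

/-- Counts the pairs (truncation level, grid point) in the union bound for block `j`. -/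
theorem card_grid_mul_le (d j : ℕ) :
    2 ^ (j + 1) * gridSize d j ^ d ≤ (2 ^ (d + 1) ^ 2) ^ (j + 5) := by
  rw [gridSize, ← pow_mul, ← pow_mul, ← pow_add]
  refine Nat.pow_le_pow_right (by norm_num) ?_
  ring_nf
  nlinarith [Nat.zero_le (j * d), Nat.zero_le d]

/-- Borel--Cantelli bound, uniform in the truncation, for the blocks of `Π_N X - X`. -/
theorem IsRealGFS.ae_eventually_norm_block_le (hX : IsRealGFS P X) (χ : DyadicPartition d)
    {V : ℕ → ℝ} (hV0 : ∀ᶠ j in atTop, 0 < V j)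
    (hV : ∀ᶠ j in atTop, ∑ k ∈ χ.modes j, ∫ ω, ‖coeff (X ω) k‖ ^ 2 ∂P ≤ V j) :
    ∀ᵐ ω ∂P, ∀ᶠ j in atTop, ∀ N, ‖(block χ j (toDistr (trunc N (X ω)) - X ω)).1‖ ≤
      2 * √(8 * (Real.log (2 * 2 ^ (d + 1) ^ 2) * (j + 5)) * V j) := by
  obtain ⟨J, hJ⟩ := eventually_atTop.1 (hV0.and hV)
  set A : ℝ := 2 ^ (d + 1) ^ 2 with hA
  have hA1 : 1 ≤ A := one_le_pow₀ (by norm_num)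
  have hlog : 0 ≤ Real.log (2 * A) := Real.log_nonneg (by linarith)
  -- This threshold makes each tail equal to `4 (2A)^{-(j+5)}`. There are at most `A^{j+5}` events,
  -- so a summable `4 · 2^{-(j+5)}` remains.
  set t : ℕ → ℝ := fun j => √(8 * (Real.log (2 * A) * (j + 5)) * V j) with ht
  -- The condition `J ≤ j` empties the events for which the variance bound is not available.
  set s : ℕ → Set Ω := fun j => {ω | J ≤ j ∧
    ∃ N : Fin (2 ^ (j + 1)), ∃ g : Fin d → Fin (gridSize d j),
      t j ≤ ‖(block χ j (toDistr (trunc N (X ω)) - X ω)).1 (gridPoint _ g)‖} with hs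
  have hsP : ∀ j, P (s j) ≤ ENNReal.ofReal (4 * (1 / 2) ^ (j + 5)) := by
    intro j
    by_cases hj : J ≤ j
    · obtain ⟨hV0, hV⟩ := hJ j hj
      have hsub : s j ⊆ ⋃ q : Fin (2 ^ (j + 1)) × (Fin d → Fin (gridSize d j)),
          {ω | t j ≤ ‖(block χ j (toDistr (trunc q.1 (X ω)) - X ω)).1 (gridPoint _ q.2)‖} := by
        rintro ω ⟨-, N, g, h⟩
        exact Set.mem_iUnion.2 ⟨(N, g), h⟩
      have hexp : Real.exp (-t j ^ 2 / (8 * V j)) = ((2 * A) ^ (j + 5))⁻¹ := by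
        rw [ht, Real.sq_sqrt (by positivity),
          show -(8 * (Real.log (2 * A) * (j + 5)) * V j) / (8 * V j) =
            -(((j + 5 : ℕ) : ℝ) * Real.log (2 * A)) by
            push_cast
            field_simp,
          Real.exp_neg, Real.exp_nat_mul, Real.exp_log (by positivity)]
      refine (measure_mono hsub).trans ((measure_iUnion_fintype_le _ _).trans ?_)
      refine (Finset.sum_le_card_nsmul _ _ _ fun q _ =>
        hX.measure_le_norm_block_apply χ q.1 j _ hV (Real.sqrt_nonneg _)).trans ?_
      rw [hexp, nsmul_eq_mul, ← ENNReal.ofReal_natCast,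
        ← ENNReal.ofReal_mul (Nat.cast_nonneg _)]
      refine ENNReal.ofReal_le_ofReal ?_
      have hcard : ((Finset.univ : Finset (Fin (2 ^ (j + 1)) × (Fin d → Fin (gridSize d j)))).card
          : ℝ) ≤ A ^ (j + 5) := by
        have h := card_grid_mul_le d j
        simp only [Finset.card_univ, Fintype.card_prod, Fintype.card_fin, Fintype.card_fun]
        rw [hA]
        exact_mod_cast h
      calc _ ≤ A ^ (j + 5) * (4 * ((2 * A) ^ (j + 5))⁻¹) := by gcongr
        _ = 4 * (1 / 2) ^ (j + 5) := by
          rw [mul_pow, one_div, inv_pow]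
          field_simp
    · have : s j = ∅ := Set.eq_empty_of_forall_notMem fun ω hω => hj hω.1
      rw [this, measure_empty]
      exact zero_le
  have hsum : ∑' j, P (s j) ≠ ∞ := by
    have h : Summable fun j : ℕ => 4 * (1 / 2 : ℝ) ^ (j + 5) :=
      ((summable_nat_add_iff 5).2 summable_geometric_two).mul_left 4
    exact ne_top_of_le_ne_top h.tsum_ofReal_ne_top (ENNReal.tsum_le_tsum hsP)
  filter_upwards [ae_eventually_notMem hsum] with ω hω
  filter_upwards [hω, eventually_ge_atTop J] with j hj hJj N
  by_cases hN : 2 ^ (j + 1) ≤ N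
  · rw [block_trunc_sub_eq_zero χ hN]
    simp
  · have hg : ∀ g : Fin d → Fin (gridSize d j),
        ‖(block χ j (toDistr (trunc N (X ω)) - X ω)).1 (gridPoint _ g)‖ ≤ t j := fun g => by
      by_contra hc
      exact hj ⟨hJj, ⟨N, not_le.1 hN⟩, g, (not_le.1 hc).le⟩
    rw [block_trunc_sub] at hg ⊢
    exact norm_le_of_gridPoint (by unfold gridSize; positivity) _
      (fun k hk i => χ.abs_le_of_mem_modes hk i) (χ.card_modes_le j) (le_gridSize d j) _
      (Real.sqrt_nonneg _) hg

end Blocks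

section Convergence

variable {d : ℕ}

/-! ### From block bounds to Besov convergence -/

section Besov

/-- The `j`-th weighted block norm of `Π_N u - u` in the definition of the Besov norm. -/
def remainderTerm (χ : DyadicPartition d) (α : ℝ) (u : Distr d) (N j : ℕ) : ℝ≥0∞ :=
  ENNReal.ofReal ((2 : ℝ) ^ (α * ((j : ℝ) - 1))) *
    eLpNorm (block χ j (toDistr (trunc N u) - u)).1 ∞ (vol d)

theorem remainderTerm_eq_zero (χ : DyadicPartition d) (α : ℝ) (u : Distr d) {N j : ℕ}
    (h : 2 ^ (j + 1) ≤ N) : remainderTerm χ α u N j = 0 := by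
  rw [remainderTerm, block_trunc_sub_eq_zero χ h]
  have : ((0 : Smooth d).1 : FlatTorus d → ℂ) = 0 := rfl
  rw [this, eLpNorm_zero, mul_zero]

theorem remainderTerm_le (χ : DyadicPartition d) (α : ℝ) (u : Distr d) {N j : ℕ} {B : ℝ}
    (h : ‖(block χ j (toDistr (trunc N u) - u)).1‖ ≤ B) :
    remainderTerm χ α u N j ≤ ENNReal.ofReal ((2 : ℝ) ^ (α * ((j : ℝ) - 1)) * B) := by
  rw [remainderTerm, ENNReal.ofReal_mul (by positivity)]
  refine mul_le_mul_right ?_ _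
  rw [eLpNorm_exponent_top]
  exact eLpNormEssSup_le_of_ae_bound (ae_of_all _ fun x =>
    ((block χ j (toDistr (trunc N u) - u)).1.norm_coe_le_norm x).trans h)

/-- Once `N ≥ 2^{m+1}`, the blocks below `m` vanish and only the tail of `w` from `m` on counts. -/
theorem eventually_remainderTerm_le (χ : DyadicPartition d) (α : ℝ) (u : Distr d) {w : ℕ → ℝ≥0∞}
    (hw : ∀ᶠ j in atTop, ∀ N, remainderTerm χ α u N j ≤ w j) :
    ∀ᶠ m in atTop, ∀ N, 2 ^ (m + 1) ≤ N → ∀ j,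
      remainderTerm χ α u N j ≤ if m ≤ j then w j else 0 := by
  obtain ⟨J, hJ⟩ := eventually_atTop.1 hw
  filter_upwards [eventually_ge_atTop J] with m hm N hN j
  split_ifs with h
  · exact hJ j (hm.trans h) N
  · refine (remainderTerm_eq_zero χ α u (le_trans ?_ hN)).le
    exact Nat.pow_le_pow_right (by norm_num) (by omega)

theorem tendsto_besovNorm_top (χ : DyadicPartition d) (α : ℝ) (u : Distr d) {w : ℕ → ℝ≥0∞}
    (hw : ∀ᶠ j in atTop, ∀ N, remainderTerm χ α u N j ≤ w j) (hw0 : Tendsto w atTop (𝓝 0)) :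
    Tendsto (fun N => besovNorm χ α ∞ ∞ (toDistr (trunc N u) - u)) atTop (𝓝 0) := by
  refine ENNReal.tendsto_nhds_zero.2 fun ε hε => ?_
  obtain ⟨m, hm, hm'⟩ := ((eventually_remainderTerm_le χ α u hw).and
    (eventually_atTop.2 <| by
      obtain ⟨J, hJ⟩ := eventually_atTop.1 (ENNReal.tendsto_nhds_zero.1 hw0 ε hε)
      exact ⟨J, fun m hm j (hj : m ≤ j) => hJ j (hm.trans hj)⟩ :
      ∀ᶠ m in atTop, ∀ j, m ≤ j → w j ≤ ε)).exists
  filter_upwards [eventually_ge_atTop (2 ^ (m + 1))] with N hN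
  simp only [besovNorm, if_pos]
  refine iSup_le fun j => (hm N hN j).trans ?_
  split_ifs with h
  · exact hm' j h
  · exact zero_le

theorem tendsto_besovNorm_of_ne_top (χ : DyadicPartition d) (α : ℝ) (u : Distr d) {q : ℝ≥0∞}
    (hq : q ≠ ∞) (hq0 : 0 < q.toReal) {w : ℕ → ℝ≥0∞}
    (hw : ∀ᶠ j in atTop, ∀ N, remainderTerm χ α u N j ≤ w j)
    (hsum : ∑' j, w j ^ q.toReal ≠ ∞) :
    Tendsto (fun N => besovNorm χ α ∞ q (toDistr (trunc N u) - u)) atTop (𝓝 0) := by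
  have h0 : Tendsto (fun N => ∑' j, remainderTerm χ α u N j ^ q.toReal) atTop (𝓝 0) := by
    refine ENNReal.tendsto_nhds_zero.2 fun ε hε => ?_
    obtain ⟨m, hm, hm'⟩ := ((eventually_remainderTerm_le χ α u hw).and
      (ENNReal.tendsto_nhds_zero.1 (ENNReal.tendsto_sum_nat_add (fun j => w j ^ q.toReal) hsum)
        ε hε)).exists
    filter_upwards [eventually_ge_atTop (2 ^ (m + 1))] with N hN
    refine le_trans ?_ hm'
    rw [← ENNReal.summable.sum_add_tsum_nat_add' (k := m), Finset.sum_eq_zero fun j hj => ?_,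
      zero_add]
    · refine ENNReal.tsum_le_tsum fun j => ENNReal.rpow_le_rpow ?_ hq0.le
      exact (hm N hN (j + m)).trans_eq (if_pos (Nat.le_add_left m j))
    · have h := hm N hN j
      rw [if_neg (not_le.2 (Finset.mem_range.1 hj)), nonpos_iff_eq_zero] at h
      rw [h, ENNReal.zero_rpow_of_pos hq0]
  have h1 := (ENNReal.continuous_rpow_const (y := 1 / q.toReal)).tendsto 0 |>.comp h0
  rw [ENNReal.zero_rpow_of_pos (by positivity)] at h1
  refine h1.congr fun N => ?_
  simp only [besovNorm, if_neg hq]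
  rfl

theorem mem_besovSpace_of_tendsto (χ : DyadicPartition d) {α : ℝ} {p q : ℝ≥0∞} {u : Distr d}
    (h : Tendsto (fun N => besovNorm χ α p q (toDistr (trunc N u) - u)) atTop (𝓝 0)) :
    u ∈ besovSpace χ α p q ∧
      Tendsto (fun N => besovNorm χ α p q (toDistr (trunc N u) - u)) atTop (𝓝 0) :=
  ⟨⟨fun N => trunc N u, h⟩, h⟩

end Besov

/-! ### Comparison of powers and logarithms -/

section Asymptotics

/-- The sign of `γ` decides which of the two comparisons is used; `|γ|` covers both cases. -/
theorem rpow_le_four_rpow_mul {s t : ℝ} (hs : 0 < s) (h1 : s / 4 ≤ t) (h2 : t ≤ 4 * s) (γ : ℝ) :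
    t ^ γ ≤ 4 ^ |γ| * s ^ γ := by
  have ht : 0 < t := lt_of_lt_of_le (by positivity) h1
  rcases le_total 0 γ with h | h
  · rw [abs_of_nonneg h, ← Real.mul_rpow (by norm_num) hs.le]
    exact Real.rpow_le_rpow ht.le h2 h
  · rw [abs_of_nonpos h, Real.rpow_neg (by norm_num), ← Real.inv_rpow (by norm_num),
      ← Real.mul_rpow (by norm_num) hs.le]
    refine Real.rpow_le_rpow_of_nonpos (by positivity) ?_ h
    linarith

/-- Comparability up to a factor `4` survives the logarithm because `16 = 4²` gives `log 4 ≤ (log s)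
/ 2`. It serves to pass from `log |k|` to `log log |k|`. -/
theorem log_mem_of_mem {s t : ℝ} (hs : 16 ≤ s) (h1 : s / 4 ≤ t) (h2 : t ≤ 4 * s) :
    Real.log s / 4 ≤ Real.log t ∧ Real.log t ≤ 4 * Real.log s := by
  have hs0 : 0 < s := by linarith
  have ht : 0 < t := lt_of_lt_of_le (by positivity) h1
  have h3 := Real.log_le_log (by positivity) h1
  have h4 := Real.log_le_log ht h2
  have h5 := Real.log_le_log (by norm_num) hs
  have h6 : 0 < Real.log 4 := Real.log_pos (by norm_num)
  rw [Real.log_div hs0.ne' (by norm_num)] at h3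
  rw [Real.log_mul (by norm_num) hs0.ne'] at h4
  rw [show (16 : ℝ) = 4 ^ 2 by norm_num, Real.log_pow] at h5
  push_cast at h5
  constructor <;> linarith

/-- `n ↦ n^a (log n)^c` is eventually dominated by `n^b` whenever `a < b`. -/
theorem eventually_rpow_mul_log_rpow_le {a b : ℝ} (hab : a < b) (c : ℝ) :
    ∀ᶠ n : ℕ in atTop, (n : ℝ) ^ a * Real.log n ^ c ≤ (n : ℝ) ^ b := by
  have h := ((isLittleO_log_rpow_rpow_atTop c (sub_pos.2 hab)).bound one_pos).and
    (eventually_gt_atTop (1 : ℝ))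
  filter_upwards [tendsto_natCast_atTop_atTop.eventually h] with n hn
  obtain ⟨h1, h2⟩ := hn
  have hn0 : (0 : ℝ) < n := by linarith
  rw [one_mul, Real.norm_of_nonneg (Real.rpow_nonneg (Real.log_nonneg h2.le) _),
    Real.norm_of_nonneg (by positivity)] at h1
  calc (n : ℝ) ^ a * Real.log n ^ c ≤ (n : ℝ) ^ a * (n : ℝ) ^ (b - a) := by gcongr
    _ = (n : ℝ) ^ b := by rw [← Real.rpow_add hn0, add_sub_cancel]

end Asymptotics

/-! ### Variance of a block and the almost sure bound -/

section Variance

variable {Ω : Type*} [MeasurableSpace Ω] {P : Measure Ω} {X : Ω → Distr d}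

/-- On block `j`, the quantities `|k|`, `log |k|` and `log log |k|` are within a factor `4` of
`2^j`, `j` and `log j`; there are at most `2^{(j+3)d}` modes. -/
theorem eventually_sum_variance_le (χ : DyadicPartition d) {γ θ η : ℝ} {σ : (Fin d → ℤ) → ℝ}
    (hσ : ∃ C R : ℝ, ∀ k : Fin d → ℤ, R < ‖freq k‖ →
      σ k ≤ C * (‖freq k‖ ^ γ * Real.log ‖freq k‖ ^ θ * Real.log (Real.log ‖freq k‖) ^ η)) :
    ∃ C : ℝ, 0 < C ∧ ∀ᶠ j : ℕ in atTop, ∑ k ∈ χ.modes j, σ k ≤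
      C * ((2 : ℝ) ^ ((j : ℝ) * (d + γ)) * (j : ℝ) ^ θ * Real.log j ^ η) := by
  obtain ⟨C, R, hσ⟩ := hσ
  -- The given constant may be nonpositive.
  set C' := max C 1 with hC'
  have hC'0 : 0 < C' := lt_of_lt_of_le one_pos (le_max_right _ _)
  refine ⟨2 ^ (3 * d) * (C' * (4 ^ |γ| * 4 ^ |θ| * 4 ^ |η|)), by positivity, ?_⟩
  have hR : ∀ᶠ j : ℕ in atTop, R ≤ 3 / 8 * 2 ^ j :=
    ((tendsto_pow_atTop_atTop_of_one_lt (by norm_num : (1 : ℝ) < 2)).const_mul_atTop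
      (by norm_num : (0 : ℝ) < 3 / 8)).eventually_ge_atTop R
  filter_upwards [hR, eventually_ge_atTop 16] with j hj hj16
  have hj16' : (16 : ℝ) ≤ j := by exact_mod_cast hj16
  have hlogj : 0 < Real.log j := Real.log_pos (by linarith)
  have h2j : (0 : ℝ) < 2 ^ j := by positivity
  have hk : ∀ k ∈ χ.modes j, σ k ≤
      C' * (4 ^ |γ| * (2 ^ j) ^ γ * (4 ^ |θ| * (j : ℝ) ^ θ) * (4 ^ |η| * Real.log j ^ η)) := by
    intro k hk
    have hlow := χ.lt_norm_freq (by omega) hk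
    have hupp := χ.norm_freq_le hk
    have hl2 := Real.log_two_gt_d9
    have hl2' := Real.log_two_lt_d9
    have hr1 : (2 : ℝ) ^ j / 4 ≤ ‖freq k‖ := by linarith
    have hr2 : ‖freq k‖ ≤ 4 * 2 ^ j := by linarith
    have hr0 : 0 < ‖freq k‖ := by linarith
    have hlog1 : (j : ℝ) / 4 ≤ Real.log ‖freq k‖ := by
      have h := Real.log_le_log (by positivity) hr1
      rw [Real.log_div h2j.ne' (by norm_num), Real.log_pow,
        show (4 : ℝ) = 2 ^ 2 by norm_num, Real.log_pow] at h
      push_cast at h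
      nlinarith
    have hlog2 : Real.log ‖freq k‖ ≤ 4 * j := by
      have h := Real.log_le_log hr0 hr2
      rw [Real.log_mul (by norm_num) h2j.ne', Real.log_pow,
        show (4 : ℝ) = 2 ^ 2 by norm_num, Real.log_pow] at h
      push_cast at h
      nlinarith
    obtain ⟨hll1, hll2⟩ := log_mem_of_mem hj16' hlog1 hlog2
    have e1 := rpow_le_four_rpow_mul h2j hr1 hr2 γ
    have e2 := rpow_le_four_rpow_mul (by linarith) hlog1 hlog2 θ
    have e3 := rpow_le_four_rpow_mul hlogj hll1 hll2 η
    have p2 : 0 ≤ Real.log ‖freq k‖ := by linarith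
    have p3 : 0 ≤ Real.log (Real.log ‖freq k‖) := by linarith
    refine (hσ k (by linarith)).trans ?_
    refine mul_le_mul (le_max_left _ _) ?_ (by positivity) hC'0.le
    gcongr
  calc ∑ k ∈ χ.modes j, σ k ≤ (χ.modes j).card • _ := Finset.sum_le_card_nsmul _ _ _ hk
    _ ≤ 2 ^ ((j + 3) * d) *
      (C' * (4 ^ |γ| * (2 ^ j) ^ γ * (4 ^ |θ| * (j : ℝ) ^ θ) * (4 ^ |η| * Real.log j ^ η))) := by
        rw [nsmul_eq_mul]
        refine mul_le_mul_of_nonneg_right ?_ (by positivity)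
        exact_mod_cast χ.card_modes_le j
    _ = _ := by
        rw [show (2 : ℝ) ^ ((j : ℝ) * (d + γ)) = 2 ^ (j * d) * (2 ^ j) ^ γ by
          rw [mul_add, Real.rpow_add (by norm_num), Real.rpow_mul (by norm_num) _ γ,
            Real.rpow_natCast, ← Nat.cast_mul, Real.rpow_natCast],
          show (j + 3) * d = 3 * d + j * d by ring, pow_add]
        ring

/-- Almost surely, the weighted blocks of `Π_N X - X` are bounded, uniformly in `N`, by a multiple
of `√(j^{1+θ} (log j)^η)`. -/
theorem IsRealGFS.ae_eventually_remainderTerm_le (hX : IsRealGFS P X) (χ : DyadicPartition d)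
    {γ θ η : ℝ}
    (hσ : ∃ C R : ℝ, ∀ k : Fin d → ℤ, R < ‖freq k‖ →
      ∫ ω, ‖coeff (X ω) k‖ ^ 2 ∂P ≤
        C * (‖freq k‖ ^ γ * Real.log ‖freq k‖ ^ θ * Real.log (Real.log ‖freq k‖) ^ η)) :
    ∃ K : ℝ, 0 ≤ K ∧ ∀ᵐ ω ∂P, ∀ᶠ j : ℕ in atTop, ∀ N,
      remainderTerm χ (-((d : ℝ) + γ) / 2) (X ω) N j ≤
        ENNReal.ofReal (K * √((j : ℝ) ^ (1 + θ) * Real.log j ^ η)) := by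
  obtain ⟨C, hC, hV⟩ := eventually_sum_variance_le χ hσ
  set V : ℕ → ℝ := fun j =>
    C * ((2 : ℝ) ^ ((j : ℝ) * (d + γ)) * (j : ℝ) ^ θ * Real.log j ^ η) with hVdef
  have hV0 : ∀ᶠ j in atTop, 0 < V j := by
    filter_upwards [eventually_ge_atTop 2] with j hj
    have hj2 : (2 : ℝ) ≤ j := by exact_mod_cast hj
    have : 0 < Real.log j := Real.log_pos (by linarith)
    positivity
  set α : ℝ := -((d : ℝ) + γ) / 2 with hα
  set L : ℝ := Real.log (2 * 2 ^ (d + 1) ^ 2) with hL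
  have hL0 : 0 ≤ L := Real.log_nonneg (by
    have : (1 : ℝ) ≤ 2 ^ (d + 1) ^ 2 := one_le_pow₀ (by norm_num)
    linarith)
  -- The factor `2 ^ (-α)` is due to the index shift `j = ℓ + 1`, and `6` comes from `j + 5 ≤ 6j`.
  refine ⟨2 ^ (-α) * (2 * √(8 * L * 6 * C)), by positivity, ?_⟩
  filter_upwards [hX.ae_eventually_norm_block_le χ hV0 hV] with ω hω
  filter_upwards [hω, eventually_ge_atTop 2] with j hj hj2 N
  refine (remainderTerm_le χ α (X ω) (hj N)).trans (ENNReal.ofReal_le_ofReal ?_)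
  have hj2' : (2 : ℝ) ≤ j := by exact_mod_cast hj2
  have hj0 : (0 : ℝ) < j := by linarith
  have hlog : 0 < Real.log j := Real.log_pos (by linarith)
  set G : ℝ := (2 : ℝ) ^ ((j : ℝ) * (d + γ)) with hG
  have hG0 : 0 < G := by positivity
  have h2 : (2 : ℝ) ^ (α * ((j : ℝ) - 1)) * √G = 2 ^ (-α) := by
    rw [hG, Real.sqrt_eq_rpow, ← Real.rpow_mul (by norm_num), ← Real.rpow_add (by norm_num)]
    congr 1
    rw [hα]
    ring
  have h3 : 8 * (L * (j + 5)) * V j ≤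
      G * (8 * L * 6 * C) * ((j : ℝ) ^ (1 + θ) * Real.log j ^ η) := by
    rw [hVdef, Real.rpow_add hj0, Real.rpow_one]
    have : (j : ℝ) + 5 ≤ 6 * j := by linarith
    calc 8 * (L * (j + 5)) * (C * (G * (j : ℝ) ^ θ * Real.log j ^ η))
        ≤ 8 * (L * (6 * j)) * (C * (G * (j : ℝ) ^ θ * Real.log j ^ η)) := by gcongr
      _ = _ := by ring
  calc (2 : ℝ) ^ (α * ((j : ℝ) - 1)) * (2 * √(8 * (L * (j + 5)) * V j))
      ≤ (2 : ℝ) ^ (α * ((j : ℝ) - 1)) *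
        (2 * √(G * (8 * L * 6 * C) * ((j : ℝ) ^ (1 + θ) * Real.log j ^ η))) := by gcongr
    _ = ((2 : ℝ) ^ (α * ((j : ℝ) - 1)) * √G) * (2 * √(8 * L * 6 * C)) *
        √((j : ℝ) ^ (1 + θ) * Real.log j ^ η) := by
        rw [Real.sqrt_mul (by positivity), Real.sqrt_mul (by positivity)]
        ring
    _ = _ := by rw [h2]

theorem tendsto_ofReal_mul_sqrt {K : ℝ} {f : ℕ → ℝ} (hf : Tendsto f atTop (𝓝 0)) :
    Tendsto (fun j => ENNReal.ofReal (K * √(f j))) atTop (𝓝 0) := by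
  have h := ENNReal.tendsto_ofReal ((hf.sqrt).const_mul K)
  rwa [Real.sqrt_zero, mul_zero, ENNReal.ofReal_zero] at h

theorem tsum_ofReal_mul_sqrt_rpow_ne_top {K θ η q : ℝ} (hK : 0 ≤ K) (hq : 0 < q)
    (hθ : (1 + θ) * (q / 2) < -1) :
    ∑' j : ℕ, ENNReal.ofReal (K * √((j : ℝ) ^ (1 + θ) * Real.log j ^ η)) ^ q ≠ ∞ := by
  -- The midpoint between the exponent and `-1`: half the gap absorbs any power of the logarithm,
  -- the other half keeps the series convergent.
  set p : ℝ := ((1 + θ) * (q / 2) - 1) / 2 with hp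
  have hp1 : p < -1 := by rw [hp]; linarith
  have hlt : (1 + θ) * (q / 2) < p := by rw [hp]; linarith
  have hlog : ∀ j : ℕ, 0 ≤ Real.log j := fun j => Real.log_natCast_nonneg j
  have hterm : ∀ j : ℕ, (K * √((j : ℝ) ^ (1 + θ) * Real.log j ^ η)) ^ q =
      K ^ q * ((j : ℝ) ^ ((1 + θ) * (q / 2)) * Real.log j ^ (η * (q / 2))) := fun j => by
    have h1 : 0 ≤ (j : ℝ) ^ (1 + θ) := by positivity
    have h2 : 0 ≤ Real.log j ^ η := Real.rpow_nonneg (hlog j) _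
    rw [Real.mul_rpow hK (Real.sqrt_nonneg _), Real.sqrt_eq_rpow, ← Real.rpow_mul (by positivity),
      Real.mul_rpow h1 h2, ← Real.rpow_mul (Nat.cast_nonneg j), ← Real.rpow_mul (hlog j)]
    ring_nf
  have hsum : Summable fun j : ℕ => (K * √((j : ℝ) ^ (1 + θ) * Real.log j ^ η)) ^ q := by
    refine Summable.of_norm_bounded_eventually_nat
      ((Real.summable_nat_rpow.2 hp1).mul_left (K ^ q)) ?_
    filter_upwards [eventually_rpow_mul_log_rpow_le hlt (η * (q / 2))] with j hj
    rw [Real.norm_of_nonneg (by positivity), hterm]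
    gcongr
  have h := hsum.tsum_ofReal_ne_top
  refine ne_of_eq_of_ne (tsum_congr fun j => ?_) h
  exact ENNReal.ofReal_rpow_of_nonneg (by positivity) hq.le

end Variance

end Convergence

end FlatTorus

end

theorem mainTheorem4 {d : ℕ} (χ : FlatTorus.DyadicPartition d)
    {Ω : Type*} [MeasurableSpace Ω] (P : Measure Ω) [IsProbabilityMeasure P]
    (X : Ω → FlatTorus.Distr d) (hX : FlatTorus.IsRealGFS P X) (γ θ η : ℝ)
    (hσ : ∃ C R : ℝ, ∀ k : Fin d → ℤ, R < ‖FlatTorus.freq k‖ →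
      ∫ ω, ‖FlatTorus.coeff (X ω) k‖ ^ 2 ∂P ≤
        C * (‖FlatTorus.freq k‖ ^ γ * Real.log ‖FlatTorus.freq k‖ ^ θ *
          Real.log (Real.log ‖FlatTorus.freq k‖) ^ η)) :
    (θ = -1 → η < 0 → ∀ᵐ ω ∂P,
      X ω ∈ FlatTorus.besovSpace χ (-((d : ℝ) + γ) / 2) ∞ ∞ ∧
      Tendsto (fun N : ℕ => FlatTorus.besovNorm χ (-((d : ℝ) + γ) / 2) ∞ ∞
        (FlatTorus.toDistr (FlatTorus.trunc N (X ω)) - X ω)) atTop (𝓝 0)) ∧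
    (θ < -1 → ∀ q : ℝ≥0∞, 1 ≤ q → ENNReal.ofReal (-2 / (θ + 1)) < q → ∀ᵐ ω ∂P,
      X ω ∈ FlatTorus.besovSpace χ (-((d : ℝ) + γ) / 2) ∞ q ∧
      Tendsto (fun N : ℕ => FlatTorus.besovNorm χ (-((d : ℝ) + γ) / 2) ∞ q
        (FlatTorus.toDistr (FlatTorus.trunc N (X ω)) - X ω)) atTop (𝓝 0)) := by
  obtain ⟨K, hK, hω⟩ := hX.ae_eventually_remainderTerm_le χ hσ
  refine ⟨fun hθ hη => ?_, fun hθ q hq1 hq => ?_⟩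
  · have h0 : Tendsto (fun j : ℕ => (j : ℝ) ^ (1 + θ) * Real.log j ^ η) atTop (𝓝 0) := by
      have h := (tendsto_rpow_neg_atTop (neg_pos.2 hη)).comp
        (Real.tendsto_log_atTop.comp tendsto_natCast_atTop_atTop)
      refine h.congr fun j => ?_
      simp [hθ]
    filter_upwards [hω] with ω hω
    exact FlatTorus.mem_besovSpace_of_tendsto χ
      (FlatTorus.tendsto_besovNorm_top χ _ _ hω (FlatTorus.tendsto_ofReal_mul_sqrt h0))
  · by_cases hqt : q = ∞
    · subst hqt
      have h0 : Tendsto (fun j : ℕ => (j : ℝ) ^ (1 + θ) * Real.log j ^ η) atTop (𝓝 0) := by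
        -- The intermediate exponent `(1 + θ) / 2` lies between `1 + θ` and `0`, which leaves room
        -- for the logarithm.
        have hpos : 0 < -((1 + θ) / 2) := by linarith
        have h := (tendsto_rpow_neg_atTop hpos).comp
          (tendsto_natCast_atTop_atTop (R := ℝ))
        rw [neg_neg] at h
        refine squeeze_zero' (Eventually.of_forall fun j => ?_)
          (FlatTorus.eventually_rpow_mul_log_rpow_le (by linarith) η) h
        exact mul_nonneg (by positivity) (Real.rpow_nonneg (Real.log_natCast_nonneg j) _)
      filter_upwards [hω] with ω hω
      exact FlatTorus.mem_besovSpace_of_tendsto χ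
        (FlatTorus.tendsto_besovNorm_top χ _ _ hω (FlatTorus.tendsto_ofReal_mul_sqrt h0))
    · have hq0 : 0 < q.toReal := ENNReal.toReal_pos (zero_lt_one.trans_le hq1).ne' hqt
      have hq2 : -2 / (θ + 1) < q.toReal :=
        (ENNReal.ofReal_lt_iff_lt_toReal (div_nonneg_of_nonpos (by norm_num) (by linarith)) hqt).1 hq
      -- The hypothesis on `q` is exactly convergence of `∑ j^{(1+θ)q/2}`; the inequality flips
      -- because `θ + 1 < 0`.
      have hθq : (1 + θ) * (q.toReal / 2) < -1 := by
        rw [div_lt_iff_of_neg (by linarith)] at hq2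
        linarith
      filter_upwards [hω] with ω hω
      exact FlatTorus.mem_besovSpace_of_tendsto χ
        (FlatTorus.tendsto_besovNorm_of_ne_top χ _ _ hqt hq0 hω
          (FlatTorus.tsum_ofReal_mul_sqrt_rpow_ne_top hK hq0 hθq))
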